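/- A punctual equivalence relation is a primitive recursive equivalence relation on $\omega$ with infinitely many classes. For equivalence relations $R,S$ on $\omega$ write $R\leq_{pr}S$ if there is a primitive recursive $f:\omega\to\omega$ with $x\mathrel{R}y\Leftrightarrow f(x)\mathrel{S}f(y)$ for all $x,y$; write $R\equiv_{pr}S$ if $R\leq_{pr}S$ and $S\leq_{pr}R$, and $R<_{pr}S$ if $R\leq_{pr}S$ and $S\not\leq_{pr}R$. Let $\mathbf{Peq}$ be the partial order of the $\equiv_{pr}$-classes (degrees) of punctual equivalence relations. For $X\subseteq\omega$ let $x\mathrel{R_X}y$ iff $x,y\in X$ or $x=y$, and let $\#(0^X)[s]$ be the number of $i\leq s$ with $i\notin X$. A pair $(X,Y)$ of infinite, coinfinite primitive recursive sets has the $\blacklozenge$-property if there are infinite, coinfinite primitive recursive sets $X^*,Y^*$ with $R_{X^*}\equiv_{pr}R_X$, $R_{Y^*}\equiv_{pr}R_Y$ and $$(\forall s)(\exists t\geq s)\ \#(0^{X^*})[t]=\#(0^{Y^*})[t].$$ A pair $(R,S)$ of punctual equivalence relations has the $\blacklozenge$-property if there is a pair $(X,Y)$ of infinite, coinfinite primitive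 recursive sets with the $\blacklozenge$-property such that $R\equiv_{pr}R_X$ and $S\equiv_{pr}R_Y$. Corollary 7.4. Let $R<_{pr}S$ be punctual equivalence relations. Then the interval $[R,S]$ of $\mathbf{Peq}$ embeds the diamond lattice (the four-element Boolean lattice) preserving $0$ and $1$ if and only if $(R,S)$ has the $\blacklozenge$-property. Here the embedding is an injective map from the diamond into $[R,S]$ that sends joins and meets of the diamond to suprema and infima in $\mathbf{Peq}$, the least element to the degree of $R$ and the greatest element to the degree of $S$. -/

import Mathlib

/-- A punctual equivalence relation: a primitive recursive equivalence relation on `ℕ`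
with infinitely many equivalence classes. -/
structure PunctualEquiv where
  rel : Setoid ℕ
  primrec_rel : PrimrecRel (fun x y : ℕ => rel x y)
  infinite_classes : Infinite (Quotient rel)

/-- `R ≤_pr S`: some primitive recursive `f` satisfies `x R y ↔ f x S f y`. -/
def PRReducible (R S : Setoid ℕ) : Prop :=
  ∃ f : ℕ → ℕ, Primrec f ∧ ∀ x y : ℕ, R x y ↔ S (f x) (f y)

/-- `R ≡_pr S`. -/
def PREquivalent (R S : Setoid ℕ) : Prop :=
  PRReducible R S ∧ PRReducible S R

/-- Punctual equivalence relations are preordered by primitive recursive reducibility. -/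
instance : Preorder PunctualEquiv where
  le R S := PRReducible R.rel S.rel
  le_refl _ := ⟨id, Primrec.id, fun _ _ => Iff.rfl⟩
  le_trans _ _ _ := fun ⟨f, hf, hf'⟩ ⟨g, hg, hg'⟩ =>
    ⟨fun x => g (f x), hg.comp hf, fun x y => (hf' x y).trans (hg' (f x) (f y))⟩

/-- The partial order of punctual degrees: punctual equivalence relations modulo
mutual primitive recursive reducibility, with the induced order. -/
abbrev Peq : Type := Antisymmetrization PunctualEquiv (· ≤ ·)

/-- The degree of a punctual equivalence relation. -/
def PunctualEquiv.deg (R : PunctualEquiv) : Peq := toAntisymmetrization (· ≤ ·) R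

/-- The relation `R_X`: `x R_X y` iff `x, y ∈ X` or `x = y`. -/
def relOfSet (X : Set ℕ) : Setoid ℕ where
  r x y := (x ∈ X ∧ y ∈ X) ∨ x = y
  iseqv :=
    { refl := fun _ => Or.inr rfl
      symm := by
        rintro x y (⟨hx, hy⟩ | h)
        · exact Or.inl ⟨hy, hx⟩
        · exact Or.inr h.symm
      trans := by
        rintro x y z (⟨hx, hy⟩ | rfl) (⟨hy', hz⟩ | rfl)
        · exact Or.inl ⟨hx, hz⟩
        · exact Or.inl ⟨hx, hy⟩
        · exact Or.inl ⟨hy', hz⟩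
        · exact Or.inr rfl }

/-- An infinite and coinfinite primitive recursive set of natural numbers. -/
structure IsPunctualSet (X : Set ℕ) : Prop where
  primrec_mem : PrimrecPred (fun n : ℕ => n ∈ X)
  infinite : X.Infinite
  coinfinite : Xᶜ.Infinite

open Classical in
/-- The number of zeros of the characteristic function of `X` among the arguments `0, …, s`. -/
noncomputable def zeroCount (X : Set ℕ) (s : ℕ) : ℕ :=
  ((Finset.range (s + 1)).filter (fun n => n ∉ X)).card

/-- The diamond property of a pair of sets: there are representatives `X'`, `Y'` of the degrees
of `R_X`, `R_Y` with the same zero-count at infinitely many stages. -/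
def SetDiamondProperty (X Y : Set ℕ) : Prop :=
  ∃ X' Y' : Set ℕ, IsPunctualSet X' ∧ IsPunctualSet Y' ∧
    PREquivalent (relOfSet X') (relOfSet X) ∧ PREquivalent (relOfSet Y') (relOfSet Y) ∧
    ∀ s : ℕ, ∃ t : ℕ, s ≤ t ∧ zeroCount X' t = zeroCount Y' t

/-- The diamond property of a pair of punctual equivalence relations: the diamond property of
sets `X`, `Y` in the normal form `R ≡_pr R_X`, `S ≡_pr R_Y`. -/
def DiamondProperty (R S : PunctualEquiv) : Prop :=
  ∃ X Y : Set ℕ, IsPunctualSet X ∧ IsPunctualSet Y ∧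
    PREquivalent R.rel (relOfSet X) ∧ PREquivalent S.rel (relOfSet Y) ∧
    SetDiamondProperty X Y

/-- The interval `[a, b]` of `Peq` embeds the diamond lattice (the four-element Boolean lattice)
preserving `0` and `1`: there is an injection of the diamond into `[a, b]` that sends joins and
meets to suprema and infima in `Peq`, the bottom to `a` and the top to `b`. -/
def EmbedsDiamond (a b : Peq) : Prop :=
  ∃ f : Bool × Bool → Set.Icc a b, Function.Injective f ∧
    (∀ x y, IsLUB {(f x : Peq), (f y : Peq)} (f (x ⊔ y) : Peq)) ∧
    (∀ x y, IsGLB {(f x : Peq), (f y : Peq)} (f (x ⊓ y) : Peq)) ∧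
    (f ⊥ : Peq) = a ∧ (f ⊤ : Peq) = b

-- Every punctual degree contains some `R_X`, and `R_X` is determined up to `≡_pr` by its zero
-- count: `R_X ≤_pr R_Y` holds iff the count of `X` is dominated by that of `Y` after a primitive
-- recursive time change. The possible counts are exactly the primitive recursive unbounded
-- functions that rise by 0 or 1 at each step, start at 0 or 1 and fall arbitrarily far behind the
-- identity (`slack`, which says that `X` is infinite). They are closed under pointwise minimum and
-- maximum, and these give infima and suprema of degrees.
--
-- A diamond thus amounts to two incomparable counts `a`, `b` whose minimum and maximum represent
-- `R` and `S`. The difference `a - b` moves by at most 1 per step, so it cannot change sign without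
-- vanishing; incomparability forces infinitely many zeros, where minimum and maximum agree.
--
-- Conversely, given counts `p ≤ q` that agree infinitely often, let `a` and `b` follow one of them
-- each and swap roles only at agreements, which keeps the steps at 0 or 1. Every primitive
-- recursive function lies below a row of the Ackermann function, so it suffices to defeat each row
-- in both directions, waiting before each swap until a witness has been found. One exists because
-- `q` is not dominated by `p`.

/-- The counting functions of the zeros of infinite, coinfinite primitive recursive sets. -/
structure IsCountFun (p : ℕ → ℕ) : Prop where
  primrec : Primrec p
  zero_le_one : p 0 ≤ 1
  le_succ : ∀ t, p t ≤ p (t + 1)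
  succ_le : ∀ t, p (t + 1) ≤ p t + 1
  unbounded : ∀ n, ∃ t, n ≤ p t
  slack : ∀ n, ∃ t, n + p t ≤ t

/-- `p` is dominated by `q` after a primitive recursive speed-up of `q`. -/
def PRDominated (p q : ℕ → ℕ) : Prop :=
  ∃ h : ℕ → ℕ, Primrec h ∧ ∀ s, p s ≤ q (h s)

-- Lattice operations on count functions.

namespace IsCountFun

variable {p q : ℕ → ℕ}

theorem monotone (hp : IsCountFun p) : Monotone p := monotone_nat_of_le_succ hp.le_succ

theorem add_le (hp : IsCountFun p) (t k : ℕ) : p (t + k) ≤ p t + k := by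
  induction k with
  | zero => simp
  | succ k ih => have := hp.succ_le (t + k); rw [← add_assoc]; omega

/-- The gap `t - p t` never shrinks, since `p` rises by at most 1 per step. -/
theorem slack_mono (hp : IsCountFun p) {n t u : ℕ} (h : n + p t ≤ t) (htu : t ≤ u) :
    n + p u ≤ u := by
  obtain ⟨k, rfl⟩ := Nat.exists_eq_add_of_le htu
  have := hp.add_le t k
  omega

theorem min (hp : IsCountFun p) (hq : IsCountFun q) : IsCountFun fun t => min (p t) (q t) where
  primrec := Primrec.nat_min.comp hp.primrec hq.primrec
  zero_le_one := (min_le_left _ _).trans hp.zero_le_one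
  le_succ t := min_le_min (hp.le_succ t) (hq.le_succ t)
  succ_le t := by have := hp.succ_le t; have := hq.succ_le t; omega
  unbounded n := by
    obtain ⟨t, ht⟩ := hp.unbounded n
    obtain ⟨u, hu⟩ := hq.unbounded n
    exact ⟨max t u, le_min (ht.trans (hp.monotone (le_max_left _ _)))
      (hu.trans (hq.monotone (le_max_right _ _)))⟩
  slack n := by
    obtain ⟨t, ht⟩ := hp.slack n
    exact ⟨t, le_trans (by gcongr; exact min_le_left _ _) ht⟩

theorem max (hp : IsCountFun p) (hq : IsCountFun q) : IsCountFun fun t => max (p t) (q t) where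
  primrec := Primrec.nat_max.comp hp.primrec hq.primrec
  zero_le_one := max_le hp.zero_le_one hq.zero_le_one
  le_succ t := max_le_max (hp.le_succ t) (hq.le_succ t)
  succ_le t := by have := hp.succ_le t; have := hq.succ_le t; omega
  unbounded n := by
    obtain ⟨t, ht⟩ := hp.unbounded n
    exact ⟨t, ht.trans (le_max_left _ _)⟩
  slack n := by
    obtain ⟨t, ht⟩ := hp.slack n
    obtain ⟨u, hu⟩ := hq.slack n
    refine ⟨Max.max t u, ?_⟩
    have h1 := hp.slack_mono ht (le_max_left t u)
    have h2 := hq.slack_mono hu (le_max_right t u)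
    omega

end IsCountFun

-- Rows of the Ackermann function as primitive recursive bounds.

theorem primrec_ack (m : ℕ) : Primrec (ack m) := by
  induction m with
  | zero => exact Primrec.succ.of_eq fun n => (ack_zero n).symm
  | succ m ih =>
    refine (Primrec.nat_rec₁ (f := fun _ r => ack m r) (ack m 1)
      (ih.comp Primrec.snd).to₂).of_eq fun n => ?_
    induction n with
    | zero => exact (ack_succ_zero m).symm
    | succ n ihn => rw [ack_succ_succ, ← ihn]

theorem Primrec.exists_lt_ack {f : ℕ → ℕ} (hf : Primrec f) : ∃ m, ∀ n, f n < ack m n :=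
  exists_lt_ack_of_nat_primrec (Primrec.nat_iff.1 hf)

/-- Stage-wise primitive recursive approximation of the Ackermann function. -/
theorem exists_primrec_ack_approx : ∃ g : ℕ → ℕ × ℕ → ℕ, Primrec₂ g ∧
    (∀ t e s, g t (e, s) ≤ t → g t (e, s) = ack e s) ∧
    ∀ e s, ∃ t₀, ∀ t, t₀ ≤ t → g t (e, s) = ack e s := by
  have hc : Computable fun n : ℕ => ack n.unpair.1 n.unpair.2 :=
    computable₂_ack.comp (Computable.fst.comp Computable.unpair)
      (Computable.snd.comp Computable.unpair)
  obtain ⟨c, hc⟩ := Nat.Partrec.Code.exists_code.1 (Partrec.nat_iff.1 hc)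
  have hc' : ∀ e s, Nat.Partrec.Code.eval c (Nat.pair e s) = Part.some (ack e s) := by
    intro e s; rw [hc]; simp
  -- The default `t + 1` exceeds `t`, so an unfinished computation never passes the test `g t (e, s)
  -- ≤ t`.
  refine ⟨fun t x => (Nat.Partrec.Code.evaln t c (Nat.pair x.1 x.2)).getD (t + 1), ?_, ?_, ?_⟩
  · refine Primrec.option_getD.comp (Nat.Partrec.Code.primrec_evaln.comp
      (((Primrec.fst.pair (Primrec.const c))).pair ?_)) (Primrec.succ.comp Primrec.fst)
    exact Primrec₂.natPair.comp (Primrec.fst.comp Primrec.snd) (Primrec.snd.comp Primrec.snd)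
  · intro t e s h
    rcases hv : Nat.Partrec.Code.evaln t c (Nat.pair e s) with _ | v
    · simp [hv] at h
    · have := Nat.Partrec.Code.evaln_sound (Option.mem_def.2 hv)
      rw [hc', Part.mem_some_iff] at this
      simp [hv, this]
  · intro e s
    have : ack e s ∈ Nat.Partrec.Code.eval c (Nat.pair e s) := by rw [hc']; simp
    obtain ⟨k, hk⟩ := Nat.Partrec.Code.evaln_complete.1 this
    refine ⟨k, fun t ht => ?_⟩
    have := Nat.Partrec.Code.evaln_mono ht hk
    rw [Option.mem_def] at this
    simp [this]

-- The domination preorder.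

namespace PRDominated

variable {p q r : ℕ → ℕ}

theorem refl (p : ℕ → ℕ) : PRDominated p p := ⟨id, Primrec.id, fun _ => le_rfl⟩

theorem of_le (h : ∀ s, p s ≤ q s) : PRDominated p q := ⟨id, Primrec.id, h⟩

/-- The arguments below `N` are absorbed by a constant time `t` with `p N ≤ q t`. -/
theorem of_eventually_le (hp : IsCountFun p) (hq : IsCountFun q) {h : ℕ → ℕ} (hh : Primrec h)
    {N : ℕ} (H : ∀ s, N ≤ s → p s ≤ q (h s)) : PRDominated p q := by
  obtain ⟨t, ht⟩ := hq.unbounded (p N)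
  refine ⟨fun s => max (h s) t, Primrec.nat_max.comp hh (Primrec.const t), fun s => ?_⟩
  rcases le_total N s with hs | hs
  · exact (H s hs).trans (hq.monotone (le_max_left _ _))
  · exact (hp.monotone hs).trans (ht.trans (hq.monotone (le_max_right _ _)))

theorem max_le (hr : IsCountFun r) (hp : PRDominated p r) (hq : PRDominated q r) :
    PRDominated (fun t => max (p t) (q t)) r := by
  obtain ⟨f, hf, hpf⟩ := hp
  obtain ⟨g, hg, hqg⟩ := hq
  exact ⟨fun s => max (f s) (g s), Primrec.nat_max.comp hf hg, fun s =>
    Nat.max_le.2 ⟨(hpf s).trans (hr.monotone (le_max_left _ _)),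
      (hqg s).trans (hr.monotone (le_max_right _ _))⟩⟩

theorem le_min (hp : IsCountFun p) (hq : IsCountFun q)
    (hrp : PRDominated r p) (hrq : PRDominated r q) :
    PRDominated r fun t => min (p t) (q t) := by
  obtain ⟨f, hf, hpf⟩ := hrp
  obtain ⟨g, hg, hqg⟩ := hrq
  exact ⟨fun s => max (f s) (g s), Primrec.nat_max.comp hf hg, fun s =>
    Nat.le_min.2 ⟨(hpf s).trans (hp.monotone (le_max_left _ _)),
      (hqg s).trans (hq.monotone (le_max_right _ _))⟩⟩

end PRDominated

-- Coincidences and incomparability.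

/-- Two incomparable counting functions agree at infinitely many arguments. -/
theorem exists_eq_of_not_dominated {p q : ℕ → ℕ} (hp : IsCountFun p) (hq : IsCountFun q)
    (hpq : ¬ PRDominated p q) (hqp : ¬ PRDominated q p) (s : ℕ) : ∃ t, s ≤ t ∧ p t = q t := by
  by_contra! hne
  -- Without further agreement the strict inequality at `s` persists, because the difference changes
  -- by at most 1 per step; this gives domination with the identity as time change.
  rcases lt_or_gt_of_ne (hne s le_rfl) with h | h
  · refine hpq (.of_eventually_le hp hq (h := id) Primrec.id (N := s) fun t ht => le_of_lt ?_)
    induction t, ht using Nat.le_induction with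
    | base => exact h
    | succ t ht ih =>
      have := hp.succ_le t; have := hq.le_succ t; have := hne (t + 1) (by omega)
      simp only [id] at *
      omega
  · refine hqp (.of_eventually_le hq hp (h := id) Primrec.id (N := s) fun t ht => le_of_lt ?_)
    induction t, ht using Nat.le_induction with
    | base => exact h
    | succ t ht ih =>
      have := hq.succ_le t; have := hp.le_succ t; have := hne (t + 1) (by omega)
      simp only [id] at *
      omega

/-- If `p ≤ q` agree infinitely often and `q` is not dominated by `p`, then `p` and `q` are the
pointwise minimum and maximum of two incomparable counting functions. These alternate between `p`
and `q`, switching at an agreement once a witness against the current Ackermann bound is found. -/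
theorem exists_incomparable_of_coincidences {p q : ℕ → ℕ} (hp : IsCountFun p) (hq : IsCountFun q)
    (hpq : ∀ t, p t ≤ q t) (hqp : ¬ PRDominated q p) (heq : ∀ s, ∃ t, s ≤ t ∧ p t = q t) :
    ∃ a b : ℕ → ℕ, IsCountFun a ∧ IsCountFun b ∧ (∀ t, min (a t) (b t) = p t) ∧
      (∀ t, max (a t) (b t) = q t) ∧ ¬ PRDominated a b ∧ ¬ PRDominated b a := by
  obtain ⟨g, hg, hg_sound, hg_complete⟩ := exists_primrec_ack_approx
  -- A state `x` records the number of swaps so far and the stage of the last one. The row under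
  -- attack is `x.1 / 2`, so each row is met once in each parity. Both `s` and its Ackermann value
  -- must lie between the last swap and `t`.
  let found : ℕ → ℕ × ℕ → Prop := fun t x => p t = q t ∧
    ∃ s < t + 1, x.2 ≤ s ∧ g t (x.1 / 2, s) ≤ t ∧ p (g t (x.1 / 2, s)) < q s
  have found_primrec : PrimrecRel found := by
    have hrel : PrimrecRel fun (s : ℕ) (y : ℕ × ℕ × ℕ) => y.2.2 ≤ s ∧
        g y.1 (y.2.1 / 2, s) ≤ y.1 ∧ p (g y.1 (y.2.1 / 2, s)) < q s := by
      have hg' : Primrec fun z : ℕ × ℕ × ℕ × ℕ => g z.2.1 (z.2.2.1 / 2, z.1) :=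
        hg.comp (Primrec.fst.comp Primrec.snd) ((Primrec.nat_div.comp
          (Primrec.fst.comp (Primrec.snd.comp Primrec.snd)) (Primrec.const 2)).pair Primrec.fst)
      exact (Primrec.nat_le.comp (Primrec.snd.comp (Primrec.snd.comp Primrec.snd)) Primrec.fst).and
        ((Primrec.nat_le.comp hg' (Primrec.fst.comp Primrec.snd)).and
          (Primrec.nat_lt.comp (hp.primrec.comp hg') (hq.primrec.comp Primrec.fst)))
    have hex : PrimrecPred fun z : ℕ × ℕ × ℕ => ∃ s < z.1 + 1, z.2.2 ≤ s ∧
        g z.1 (z.2.1 / 2, s) ≤ z.1 ∧ p (g z.1 (z.2.1 / 2, s)) < q s :=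
      (hrel.exists_mem_list.comp (Primrec.list_range.comp (Primrec.succ.comp Primrec.fst))
        Primrec.id).of_eq (by simp)
    exact (Primrec.eq.comp (hp.primrec.comp Primrec.fst) (hq.primrec.comp Primrec.fst)).and hex
  classical
  let state : ℕ → ℕ × ℕ := fun t => Nat.rec (0, 0)
    (fun t x => if found t x then (x.1 + 1, t + 1) else x) t
  have state_succ (t : ℕ) : state (t + 1) =
      if found t (state t) then ((state t).1 + 1, t + 1) else state t := rfl
  have state_primrec : Primrec state :=
    Primrec.nat_rec₁ _ (Primrec.ite found_primrec
      ((Primrec.succ.comp (Primrec.fst.comp Primrec.snd)).pair (Primrec.succ.comp Primrec.fst))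
      Primrec.snd)
  have mode_const (t : ℕ) : (state t).2 ≤ t ∧
      ∀ u, (state t).2 ≤ u → u ≤ t → (state u).1 = (state t).1 := by
    induction t with
    | zero => exact ⟨le_rfl, fun u _ hu => by rw [Nat.le_zero.1 hu]⟩
    | succ t ih =>
      rw [state_succ]
      split_ifs with hf
      · refine ⟨le_rfl, fun u h1 h2 => ?_⟩
        obtain rfl : u = t + 1 := le_antisymm h2 h1
        rw [state_succ, if_pos hf]
      · refine ⟨by omega, fun u h1 h2 => ?_⟩
        rcases Nat.le_succ_iff.1 h2 with h2 | rfl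
        · exact ih.2 u h1 h2
        · rw [state_succ, if_neg hf]
  -- If the search never succeeded, the state would freeze and its Ackermann row would witness that
  -- `p` dominates `q`.
  have exists_found_after (t₀ : ℕ) : ∃ t, t₀ ≤ t ∧ found t (state t) := by
    by_contra! hno
    have hstay : ∀ t, t₀ ≤ t → state t = state t₀ := by
      intro t ht
      induction t, ht using Nat.le_induction with
      | base => rfl
      | succ t ht ih => rw [state_succ, if_neg (hno t ht), ih]
    refine hqp (.of_eventually_le hq hp (primrec_ack ((state t₀).1 / 2)) (N := (state t₀).2)
      fun s hs => ?_)
    by_contra! hlt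
    obtain ⟨k, hk⟩ := hg_complete ((state t₀).1 / 2) s
    -- An agreement so late that the approximation has settled and both `s` and its Ackermann value
    -- are at most `t`.
    obtain ⟨t, ht, hpqt⟩ := heq (t₀ + k + s + ack ((state t₀).1 / 2) s)
    refine hno t (by omega) ?_
    rw [hstay t (by omega)]
    exact ⟨hpqt, s, by omega, hs, by rw [hk t (by omega)]; omega, by rwa [hk t (by omega)]⟩
  have exists_found_of_state (t₀ : ℕ) : ∃ t, state t = state t₀ ∧ found t (state t) := by
    have hex := exists_found_after t₀
    obtain ⟨h1, h2⟩ := Nat.find_spec hex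
    have hstay : ∀ t, t₀ ≤ t → t ≤ Nat.find hex → state t = state t₀ := by
      intro t ht
      induction t, ht using Nat.le_induction with
      | base => intro _; rfl
      | succ t ht ih =>
        intro hlt
        have := Nat.find_min hex (m := t) (by omega)
        rw [state_succ, if_neg fun h => this ⟨ht, h⟩, ih (by omega)]
    exact ⟨Nat.find hex, hstay _ h1 le_rfl, h2⟩
  have exists_found (m : ℕ) : ∃ t, (state t).1 = m ∧ found t (state t) := by
    induction m with
    | zero =>
      obtain ⟨t, ht, hf⟩ := exists_found_of_state 0
      exact ⟨t, congrArg Prod.fst ht, hf⟩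
    | succ m ih =>
      obtain ⟨t₀, h₀, hf₀⟩ := ih
      obtain ⟨t, ht, hf⟩ := exists_found_of_state (t₀ + 1)
      exact ⟨t, by rw [ht, state_succ, if_pos hf₀, h₀], hf⟩
  have witness (m : ℕ) : ∃ s, (state s).1 = m ∧ (state (ack (m / 2) s)).1 = m ∧
      p (ack (m / 2) s) < q s := by
    obtain ⟨t, rfl, -, s, hst, hs, hgt, hlt⟩ := exists_found m
    have hv := hg_sound _ _ _ hgt
    rw [hv] at hgt hlt
    exact ⟨s, (mode_const t).2 s hs (by omega), (mode_const t).2 _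
      (hs.trans (lt_ack_right _ _).le) hgt, hlt⟩
  have mode_succ (t : ℕ) (h : p t ≠ q t) : (state (t + 1)).1 = (state t).1 := by
    rw [state_succ, if_neg fun hf => h hf.1]
  have even_primrec : PrimrecPred fun t => (state t).1 % 2 = 0 :=
    Primrec.eq.comp (Primrec.nat_mod.comp (Primrec.fst.comp state_primrec) (Primrec.const 2))
      (Primrec.const 0)
  let a : ℕ → ℕ := fun t => if (state t).1 % 2 = 0 then q t else p t
  let b : ℕ → ℕ := fun t => if (state t).1 % 2 = 0 then p t else q t
  have between {c : ℕ → ℕ} (hc : Primrec c)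
      (h : c = a ∨ c = b) : IsCountFun c := by
    have hpc : ∀ t, p t ≤ c t := by
      rintro t
      have := hpq t
      rcases h with rfl | rfl <;> simp only [a, b] <;> split_ifs <;> omega
    have hcq : ∀ t, c t ≤ q t := by
      rintro t
      have := hpq t
      rcases h with rfl | rfl <;> simp only [a, b] <;> split_ifs <;> omega
    -- At an agreement `c t` equals both values, so either continuation is a legal step; elsewhere
    -- the mode is unchanged and the step is that of `p` or `q`.
    have hstep : ∀ t, c t ≤ c (t + 1) ∧ c (t + 1) ≤ c t + 1 := by
      intro t
      have h1 := hp.le_succ t; have h2 := hp.succ_le t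
      have h3 := hq.le_succ t; have h4 := hq.succ_le t
      by_cases heq' : p t = q t
      · have := hpc t; have := hcq t; have := hpc (t + 1); have := hcq (t + 1)
        omega
      · have := mode_succ t heq'
        rcases h with rfl | rfl <;> simp only [a, b, this] <;> split_ifs <;> omega
    refine ⟨hc, (hcq 0).trans hq.zero_le_one, fun t => (hstep t).1, fun t => (hstep t).2,
      fun n => ?_, fun n => ?_⟩
    · obtain ⟨t, ht⟩ := hp.unbounded n
      exact ⟨t, ht.trans (hpc t)⟩
    · obtain ⟨t, ht⟩ := hq.slack n
      exact ⟨t, le_trans (by gcongr; exact hcq t) ht⟩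
  have ha : IsCountFun a := between (Primrec.ite even_primrec hq.primrec hp.primrec) (.inl rfl)
  have hb : IsCountFun b := between (Primrec.ite even_primrec hp.primrec hq.primrec) (.inr rfl)
  refine ⟨a, b, ha, hb, fun t => ?_, fun t => ?_, ?_, ?_⟩
  · have := hpq t
    simp only [a, b]; split_ifs <;> omega
  · have := hpq t
    simp only [a, b]; split_ifs <;> omega
  -- In mode `2 * e`, `a` is `q` and `b` is `p` both at `s` and at `ack e s`, so `b (h s) ≤ p (ack e
  -- s) < q s = a s`.
  · rintro ⟨h, hh, hab⟩
    obtain ⟨e, he⟩ := hh.exists_lt_ack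
    obtain ⟨s, h1, h2, h3⟩ := witness (2 * e)
    rw [Nat.mul_div_cancel_left _ two_pos] at h2 h3
    have h4 := (hab s).trans (hb.monotone (he s).le)
    simp only [a, b, h1, h2, Nat.mul_mod_right, if_true] at h4
    omega
  · rintro ⟨h, hh, hab⟩
    obtain ⟨e, he⟩ := hh.exists_lt_ack
    obtain ⟨s, h1, h2, h3⟩ := witness (2 * e + 1)
    rw [show (2 * e + 1) / 2 = e by omega] at h2 h3
    have h4 := (hab s).trans (ha.monotone (he s).le)
    have hodd : ¬ (2 * e + 1) % 2 = 0 := by omega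
    simp only [a, b, h1, h2, hodd, if_false] at h4
    omega

-- Zero counts and reducibility between the relations `R_X`.

theorem zeroCount_succ_of_mem {X : Set ℕ} {n : ℕ} (h : n + 1 ∈ X) :
    zeroCount X (n + 1) = zeroCount X n := by
  simp [zeroCount, Finset.range_add_one (n := n + 1), Finset.filter_insert, h]

theorem zeroCount_succ_of_notMem {X : Set ℕ} {n : ℕ} (h : n + 1 ∉ X) :
    zeroCount X (n + 1) = zeroCount X n + 1 := by
  simp [zeroCount, Finset.range_add_one (n := n + 1), Finset.filter_insert, h]

theorem zeroCount_zero_of_mem {X : Set ℕ} (h : 0 ∈ X) : zeroCount X 0 = 0 := by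
  simp [zeroCount, Finset.filter_singleton, h]

theorem zeroCount_zero_of_notMem {X : Set ℕ} (h : 0 ∉ X) : zeroCount X 0 = 1 := by
  simp [zeroCount, Finset.filter_singleton, h]

theorem zeroCount_mono (X : Set ℕ) : Monotone (zeroCount X) := by
  refine monotone_nat_of_le_succ fun n => ?_
  by_cases h : n + 1 ∈ X
  · rw [zeroCount_succ_of_mem h]
  · rw [zeroCount_succ_of_notMem h]; omega

theorem zeroCount_lt {X : Set ℕ} {m n : ℕ} (hmn : m < n) (hn : n ∉ X) :
    zeroCount X m < zeroCount X n := by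
  obtain ⟨k, rfl⟩ : ∃ k, n = k + 1 := ⟨n - 1, by omega⟩
  rw [zeroCount_succ_of_notMem hn]
  exact Nat.lt_succ_of_le (zeroCount_mono X (by omega))

theorem zeroCount_injOn (X : Set ℕ) : Set.InjOn (zeroCount X) Xᶜ := by
  intro x hx y hy h
  rcases lt_trichotomy x y with hxy | hxy | hxy
  · exact absurd h (zeroCount_lt hxy hy).ne
  · exact hxy
  · exact absurd h (zeroCount_lt hxy hx).ne'

theorem zeroCount_pos {X : Set ℕ} {n : ℕ} (hn : n ∉ X) : 0 < zeroCount X n :=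
  Finset.card_pos.2 ⟨n, by simp [hn]⟩

/-- Discrete intermediate values: the count rises only at non-members, and by 1. -/
theorem exists_notMem_zeroCount_eq {X : Set ℕ} {n t : ℕ} (hn : 0 < n) (ht : n ≤ zeroCount X t) :
    ∃ y ≤ t, y ∉ X ∧ zeroCount X y = n := by
  induction t with
  | zero =>
    by_cases h : 0 ∈ X
    · rw [zeroCount_zero_of_mem h] at ht; omega
    · exact ⟨0, le_rfl, h, by rw [zeroCount_zero_of_notMem h] at *; omega⟩
  | succ t ih =>
    by_cases hle : n ≤ zeroCount X t
    · obtain ⟨y, hy, h⟩ := ih hle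
      exact ⟨y, by omega, h⟩
    · by_cases h : t + 1 ∈ X
      · rw [zeroCount_succ_of_mem h] at ht; omega
      · exact ⟨t + 1, le_rfl, h, by rw [zeroCount_succ_of_notMem h] at *; omega⟩

theorem IsPunctualSet.isCountFun {X : Set ℕ} (hX : IsPunctualSet X) :
    IsCountFun (zeroCount X) := by
  classical
  have succ_le (t : ℕ) : zeroCount X (t + 1) ≤ zeroCount X t + 1 := by
    by_cases h : t + 1 ∈ X
    · rw [zeroCount_succ_of_mem h]; omega
    · rw [zeroCount_succ_of_notMem h]
  refine ⟨?_, ?_, fun t => zeroCount_mono X t.le_succ, succ_le, fun n => ?_, fun n => ?_⟩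
  · refine (Primrec.nat_rec₁ (f := fun n r => if n + 1 ∈ X then r else r + 1) (zeroCount X 0)
      (Primrec.ite (hX.primrec_mem.comp (Primrec.succ.comp Primrec.fst)) Primrec.snd
        (Primrec.succ.comp Primrec.snd)).to₂).of_eq fun n => ?_
    induction n with
    | zero => rfl
    | succ n ih =>
      by_cases h : n + 1 ∈ X
      · simp only [h, if_true, zeroCount_succ_of_mem]; exact ih
      · rw [zeroCount_succ_of_notMem h, ← ih]; simp only [h, if_false]
  · by_cases h : 0 ∈ X
    · rw [zeroCount_zero_of_mem h]; omega
    · rw [zeroCount_zero_of_notMem h]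
  · induction n with
    | zero => exact ⟨0, Nat.zero_le _⟩
    | succ n ih =>
      obtain ⟨t, ht⟩ := ih
      obtain ⟨u, hu, htu⟩ := hX.coinfinite.exists_gt t
      exact ⟨u, ht.trans_lt (zeroCount_lt htu hu)⟩
  -- Since `t + 1` numbers are counted up to `t`, the inequality says that at least `n` of them lie
  -- in `X`.
  · have step (n t : ℕ) (h : n + zeroCount X t ≤ t + 1) (u : ℕ) (hu : t ≤ u) :
        n + zeroCount X u ≤ u + 1 := by
      induction u, hu using Nat.le_induction with
      | base => exact h
      | succ u _ ih => have := succ_le u; omega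
    have key (n : ℕ) : ∃ t, n + zeroCount X t ≤ t + 1 := by
      induction n with
      | zero =>
        refine ⟨0, ?_⟩
        by_cases h : 0 ∈ X
        · rw [zeroCount_zero_of_mem h]; omega
        · rw [zeroCount_zero_of_notMem h]
      | succ n ih =>
        obtain ⟨t, ht⟩ := ih
        obtain ⟨u, hu, htu⟩ := hX.infinite.exists_gt t
        obtain ⟨v, rfl⟩ : ∃ v, u = v + 1 := ⟨u - 1, by omega⟩
        refine ⟨v + 1, ?_⟩
        have := step n t ht v (by omega)
        rw [zeroCount_succ_of_mem hu]
        omega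
    obtain ⟨t, ht⟩ := key (n + 1)
    exact ⟨t, by omega⟩

theorem IsCountFun.exists_zeroCount_eq {p : ℕ → ℕ} (hp : IsCountFun p) :
    ∃ X, IsPunctualSet X ∧ zeroCount X = p := by
  classical
  -- The members are the stages where `p` does not rise, with value 0 imagined before stage 0.
  let X : Set ℕ := {t | p t = if t = 0 then 0 else p (t - 1)}
  have mem_succ (t : ℕ) : t + 1 ∈ X ↔ p (t + 1) = p t := by simp [X]
  have mem_zero : 0 ∈ X ↔ p 0 = 0 := by simp [X]
  have count : zeroCount X = p := by
    funext t
    induction t with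
    | zero =>
      have := hp.zero_le_one
      by_cases h : 0 ∈ X
      · rw [zeroCount_zero_of_mem h, mem_zero.1 h]
      · rw [zeroCount_zero_of_notMem h]; rw [mem_zero] at h; omega
    | succ t ih =>
      have := hp.le_succ t; have := hp.succ_le t
      by_cases h : t + 1 ∈ X
      · rw [zeroCount_succ_of_mem h, (mem_succ t).1 h, ih]
      · rw [zeroCount_succ_of_notMem h, ih]; rw [mem_succ] at h; omega
  refine ⟨X, ⟨?_, ?_, ?_⟩, count⟩
  · exact Primrec.eq.comp hp.primrec (Primrec.ite (Primrec.eq.comp Primrec.id (Primrec.const 0))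
      (Primrec.const 0) (hp.primrec.comp Primrec.pred))
  · refine Set.infinite_of_forall_exists_gt fun N => ?_
    by_contra! hno
    have grow (k : ℕ) : k ≤ p (N + k) := by
      induction k with
      | zero => exact Nat.zero_le _
      | succ k ih =>
        have h1 : p (N + k + 1) ≠ p (N + k) := fun h => by
          have := hno _ ((mem_succ (N + k)).2 h); omega
        have := hp.le_succ (N + k)
        rw [← add_assoc]
        omega
    obtain ⟨t, ht⟩ := hp.slack (N + 1)
    have := grow (t - N)
    rw [show N + (t - N) = t by omega] at this
    omega
  · refine Set.infinite_of_forall_exists_gt fun N => ?_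
    obtain ⟨t, ht⟩ := hp.unbounded (p N + 1)
    rw [← count] at ht
    obtain ⟨y, -, hy, hyc⟩ := exists_notMem_zeroCount_eq (by omega) ht
    refine ⟨y, hy, ?_⟩
    by_contra! hle
    have := zeroCount_mono X hle
    omega

/-- A reduction sends inequivalent points to inequivalent points, so an initial segment of zeros of
`X` needs enough zeros of `Y` below a bound for the images. Conversely, the `n`-th zero of `X` is
sent to the `n`-th zero of `Y`, found by a search bounded by the time change. -/
theorem prReducible_relOfSet_iff {X Y : Set ℕ} (hX : IsPunctualSet X) (hY : IsPunctualSet Y) :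
    PRReducible (relOfSet X) (relOfSet Y) ↔ PRDominated (zeroCount X) (zeroCount Y) := by
  classical
  have rel_iff (Z : Set ℕ) (x y : ℕ) : relOfSet Z x y ↔ (x ∈ Z ∧ y ∈ Z) ∨ x = y := Iff.rfl
  obtain ⟨x₀, hx₀⟩ := hX.infinite.nonempty
  obtain ⟨y₀, hy₀⟩ := hY.infinite.nonempty
  constructor
  · rintro ⟨f, hf, hred⟩
    obtain ⟨m, hm⟩ := hf.exists_lt_ack
    refine ⟨fun s => max (ack m s) (f x₀),
      Primrec.nat_max.comp (primrec_ack m) (Primrec.const _), fun s => ?_⟩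
    -- At most one image of these inequivalent points falls in `Y`; adjoining `x₀ ∈ X` to the zeros
    -- compensates for that loss.
    let Z := (Finset.range (s + 1)).filter (· ∉ X)
    have hxZ : x₀ ∉ Z := by simp [Z, hx₀]
    have inj : Set.InjOn f (insert x₀ Z : Finset ℕ) := by
      intro x hx y hy hxy
      have := (hred x y).2 (by rw [hxy])
      simp only [Finset.coe_insert, Set.mem_insert_iff, Finset.mem_coe, Z,
        Finset.mem_filter] at hx hy
      rw [rel_iff] at this
      grind
    have card_mem : (((insert x₀ Z).image f).filter (· ∈ Y)).card ≤ 1 := by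
      rw [Finset.card_le_one]
      intro u hu v hv
      simp only [Finset.mem_filter, Finset.mem_image] at hu hv
      obtain ⟨⟨x, hx, rfl⟩, hxY⟩ := hu
      obtain ⟨⟨y, hy, rfl⟩, hyY⟩ := hv
      have := (hred x y).2 (.inl ⟨hxY, hyY⟩)
      rw [rel_iff] at this
      simp only [Z, Finset.mem_insert, Finset.mem_filter] at hx hy
      grind
    have sub : ((insert x₀ Z).image f).filter (· ∉ Y) ⊆
        (Finset.range (max (ack m s) (f x₀) + 1)).filter (· ∉ Y) := by
      intro u hu
      simp only [Finset.mem_filter, Finset.mem_image, Finset.mem_range] at hu ⊢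
      obtain ⟨⟨x, hx, rfl⟩, hxY⟩ := hu
      refine ⟨Nat.lt_succ_of_le ?_, hxY⟩
      rcases Finset.mem_insert.1 hx with rfl | hx
      · exact le_max_right _ _
      · have hxs : x ≤ s := by simp only [Z, Finset.mem_filter, Finset.mem_range] at hx; omega
        exact ((hm x).le.trans (ack_mono_right m hxs)).trans (le_max_left _ _)
    have h1 := Finset.card_filter_add_card_filter_not (s := (insert x₀ Z).image f) (· ∈ Y)
    rw [Finset.card_image_of_injOn inj, Finset.card_insert_of_notMem hxZ] at h1
    have h2 := Finset.card_le_card sub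
    have h3 : zeroCount X s = Z.card := by simp only [zeroCount, Z]
    have h4 : zeroCount Y (max (ack m s) (f x₀)) =
      ((Finset.range (max (ack m s) (f x₀) + 1)).filter (· ∉ Y)).card := by
      simp only [zeroCount]
    dsimp only
    omega
  · rintro ⟨h, hh, hdom⟩
    let P : ℕ → ℕ → Prop := fun x y => y ∉ Y ∧ zeroCount Y y = zeroCount X x
    let f : ℕ → ℕ := fun x => if x ∈ X then y₀ else Nat.findGreatest (P x) (h x)
    have hf_mem {x : ℕ} (hx : x ∈ X) : f x ∈ Y := by simp only [f, hx, if_true, hy₀]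
    have hf_notMem {x : ℕ} (hx : x ∉ X) : f x ∉ Y ∧ zeroCount Y (f x) = zeroCount X x := by
      obtain ⟨y, hy, hP⟩ := exists_notMem_zeroCount_eq (zeroCount_pos hx) (hdom x)
      simp only [f, hx, if_false]
      exact Nat.findGreatest_spec (P := P x) hy hP
    refine ⟨f, ?_, fun x y => ?_⟩
    · refine Primrec.ite hX.primrec_mem (Primrec.const _) (Primrec.nat_findGreatest hh ?_)
      exact (hY.primrec_mem.comp Primrec.snd).not.and (Primrec.eq.comp
        (hY.isCountFun.primrec.comp Primrec.snd) (hX.isCountFun.primrec.comp Primrec.fst))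
    · rw [rel_iff, rel_iff]
      clear_value f
      by_cases hx : x ∈ X <;> by_cases hy : y ∈ X
      · simp [hx, hy, hf_mem]
      · have h1 := hf_mem hx; have h2 := (hf_notMem hy).1
        grind
      · have h1 := hf_mem hy; have h2 := (hf_notMem hx).1
        grind
      · have h1 := hf_notMem hy; have h2 := hf_notMem hx
        have h3 : f x = f y → x = y := fun h => zeroCount_injOn X hx hy (by rw [← h1.2, ← h2.2, h])
        grind

-- Normal form for punctual equivalence relations.

/-- Every punctual equivalence relation is equivalent to some `R_X`. -/
theorem PunctualEquiv.exists_prEquivalent_relOfSet (R : PunctualEquiv) :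
    ∃ X, IsPunctualSet X ∧ PREquivalent R.rel (relOfSet X) := by
  classical
  -- The zeros are the `2 * m` with `m > 0` least in its class. The class of 0 is represented by `X`
  -- itself, and the odd numbers make `X` infinite.
  let X : Set ℕ := {n | n % 2 = 1 ∨ n = 0 ∨ ∃ y < n / 2, R.rel y (n / 2)}
  have rel_iff (x y : ℕ) : relOfSet X x y ↔ (x ∈ X ∧ y ∈ X) ∨ x = y := Iff.rfl
  have hex (x : ℕ) : ∃ y, R.rel x y := ⟨x, R.rel.refl x⟩
  let mn : ℕ → ℕ := fun x => Nat.find (hex x)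
  have hmn (x : ℕ) : R.rel x (mn x) := Nat.find_spec (hex x)
  have hmn_le {x y : ℕ} (h : R.rel x y) : mn x ≤ y := Nat.find_min' (hex x) h
  have mn_eq_iff (x y : ℕ) : R.rel x y ↔ mn x = mn y :=
    ⟨fun h => le_antisymm (hmn_le (R.rel.trans h (hmn y)))
      (hmn_le (R.rel.trans (R.rel.symm h) (hmn x))),
     fun h => R.rel.trans (hmn x) (h ▸ R.rel.symm (hmn y))⟩
  have mn_notMem {x : ℕ} (h : mn x ≠ 0) : 2 * mn x ∉ X := by
    rintro (h1 | h1 | ⟨y, hy, h1⟩)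
    · omega
    · omega
    · rw [Nat.mul_div_cancel_left _ two_pos] at hy h1
      exact absurd (hmn_le (R.rel.trans (hmn x) (R.rel.symm h1))) (by omega)
  have mem_primrec : PrimrecPred (fun n : ℕ => n ∈ X) := by
    have hd : Primrec fun n : ℕ => n / 2 := Primrec.nat_div.comp Primrec.id (Primrec.const 2)
    exact (Primrec.eq.comp (Primrec.nat_mod.comp Primrec.id (Primrec.const 2))
      (Primrec.const 1)).or ((Primrec.eq.comp Primrec.id (Primrec.const 0)).or
        (R.primrec_rel.exists_lt.comp hd hd))
  have mn_primrec : Primrec mn := by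
    refine Primrec.of_graph ⟨id, Primrec.id, fun x => hmn_le (R.rel.refl x)⟩ ?_
    have hlt : PrimrecRel fun (x y : ℕ) => ∀ z < y, ¬ R.rel z x :=
      (R.primrec_rel.not.forall_lt).comp Primrec.snd Primrec.fst
    refine (R.primrec_rel.and hlt).of_eq fun x => ?_
    have := Nat.find_eq_iff (hex x.1) (m := x.2)
    simp only [mn, this]
    exact and_congr_right fun _ => forall₂_congr fun z _ => not_congr ⟨R.rel.symm, R.rel.symm⟩
  have half_rel {m n : ℕ} (hm : m ∉ X) (hn : n ∉ X) (h : R.rel (m / 2) (n / 2)) : m = n := by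
    simp only [X, Set.mem_ofPred_eq, not_or, not_exists, not_and] at hm hn
    rcases lt_trichotomy (m / 2) (n / 2) with hlt | heq | hlt
    · exact absurd h (hn.2.2 _ hlt)
    · omega
    · exact absurd (R.rel.symm h) (hm.2.2 _ hlt)
  have zero_rel {n : ℕ} (hn : n ∉ X) : ¬ R.rel 0 (n / 2) := by
    simp only [X, Set.mem_ofPred_eq, not_or, not_exists, not_and] at hn
    exact hn.2.2 0 (by omega)
  refine ⟨X, ⟨mem_primrec, ?_, ?_⟩, ⟨fun x => 2 * mn x, ?_, fun x y => ?_⟩,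
    ⟨fun n => if n ∈ X then 0 else n / 2, ?_, fun m n => ?_⟩⟩
  · exact Set.infinite_of_forall_exists_gt fun N => ⟨2 * N + 1, .inl (by omega), by omega⟩
  · intro hfin
    have := R.infinite_classes
    refine Set.infinite_univ (α := Quotient R.rel)
      (((hfin.insert 0).image fun n => (⟦n / 2⟧ : Quotient R.rel)).subset ?_)
    rintro q -
    obtain ⟨x, rfl⟩ := Quotient.exists_rep q
    refine ⟨2 * mn x, ?_, Quotient.sound ?_⟩
    · by_cases h : mn x = 0
      · simp [h]
      · exact .inr (mn_notMem h)
    · rw [Nat.mul_div_cancel_left _ two_pos]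
      exact R.rel.symm (hmn x)
  · exact Primrec.nat_mul.comp (Primrec.const 2) mn_primrec
  · rw [mn_eq_iff, rel_iff]
    dsimp only
    have h1 : 2 * mn x ∈ X → mn x = 0 := fun h => by_contra fun h' => mn_notMem h' h
    have h2 : 2 * mn y ∈ X → mn y = 0 := fun h => by_contra fun h' => mn_notMem h' h
    refine ⟨fun h => .inr (by rw [h]), ?_⟩
    rintro (⟨hx, hy⟩ | h)
    · rw [h1 hx, h2 hy]
    · omega
  · exact Primrec.ite mem_primrec (Primrec.const 0)
      (Primrec.nat_div.comp Primrec.id (Primrec.const 2))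
  · rw [rel_iff]
    by_cases hm : m ∈ X <;> by_cases hn : n ∈ X
    · simp [hm, hn]
    · simp only [hm, hn, and_false, false_or, if_true, if_false, zero_rel hn, iff_false]
      rintro rfl; exact hn hm
    · simp only [hm, hn, and_true, false_or, if_true, if_false]
      refine ⟨?_, fun h => absurd (R.rel.symm h) (zero_rel hm)⟩
      rintro rfl; exact absurd hn hm
    · simp only [hm, hn, and_false, false_or, if_false]
      exact ⟨fun h => h ▸ R.rel.refl _, half_rel hm hn⟩

/-- The relation `R_X` of an infinite, coinfinite primitive recursive set, as a punctual
equivalence relation. -/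
def IsPunctualSet.toPunctualEquiv {X : Set ℕ} (hX : IsPunctualSet X) : PunctualEquiv where
  rel := relOfSet X
  primrec_rel := ((hX.primrec_mem.comp Primrec.fst).and (hX.primrec_mem.comp Primrec.snd)).or
    Primrec.eq
  infinite_classes := by
    have : Infinite (Xᶜ : Set ℕ) := hX.coinfinite.to_subtype
    refine Infinite.of_injective
      (fun x : (Xᶜ : Set ℕ) => (⟦(x : ℕ)⟧ : Quotient (relOfSet X))) fun x y h => ?_
    rcases Quotient.exact h with ⟨hx, -⟩ | h
    · exact absurd hx x.2
    · exact Subtype.ext h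

theorem PRReducible.trans {R S T : Setoid ℕ} (h₁ : PRReducible R S) (h₂ : PRReducible S T) :
    PRReducible R T := by
  obtain ⟨f, hf, hf'⟩ := h₁
  obtain ⟨g, hg, hg'⟩ := h₂
  exact ⟨fun x => g (f x), hg.comp hf, fun x y => (hf' x y).trans (hg' (f x) (f y))⟩

theorem PREquivalent.symm {R S : Setoid ℕ} (h : PREquivalent R S) : PREquivalent S R :=
  ⟨h.2, h.1⟩

theorem PREquivalent.trans {R S T : Setoid ℕ} (h₁ : PREquivalent R S) (h₂ : PREquivalent S T) :
    PREquivalent R T :=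
  ⟨h₁.1.trans h₂.1, h₂.2.trans h₁.2⟩

theorem PREquivalent.refl (R : Setoid ℕ) : PREquivalent R R :=
  ⟨⟨id, Primrec.id, fun _ _ => Iff.rfl⟩, ⟨id, Primrec.id, fun _ _ => Iff.rfl⟩⟩

-- Count functions as coordinates on degrees.

/-- `p` counts the zeros of some punctual set `X` with `R ≡_pr R_X`. -/
def HasCount (R : PunctualEquiv) (p : ℕ → ℕ) : Prop :=
  ∃ X, IsPunctualSet X ∧ PREquivalent R.rel (relOfSet X) ∧ zeroCount X = p

namespace HasCount

variable {R S T : PunctualEquiv} {p q : ℕ → ℕ}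

theorem isCountFun (h : HasCount R p) : IsCountFun p := by
  obtain ⟨X, hX, -, rfl⟩ := h
  exact hX.isCountFun

theorem exists_count (R : PunctualEquiv) : ∃ p, HasCount R p := by
  obtain ⟨X, hX, hR⟩ := R.exists_prEquivalent_relOfSet
  exact ⟨_, X, hX, hR, rfl⟩

theorem exists_punctualEquiv (hp : IsCountFun p) : ∃ R, HasCount R p := by
  obtain ⟨X, hX, rfl⟩ := hp.exists_zeroCount_eq
  exact ⟨hX.toPunctualEquiv, X, hX, .refl _, rfl⟩

theorem le_iff (hR : HasCount R p) (hS : HasCount S q) : R ≤ S ↔ PRDominated p q := by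
  obtain ⟨X, hX, hRX, rfl⟩ := hR
  obtain ⟨Y, hY, hSY, rfl⟩ := hS
  rw [← prReducible_relOfSet_iff hX hY]
  exact ⟨fun h => (hRX.2.trans h).trans hSY.1, fun h => (hRX.1.trans h).trans hSY.2⟩

theorem deg_le_iff (hR : HasCount R p) (hS : HasCount S q) :
    R.deg ≤ S.deg ↔ PRDominated p q :=
  hR.le_iff hS

theorem of_deg_eq (hR : HasCount R p) (h : R.deg = S.deg) : HasCount S p := by
  obtain ⟨X, hX, hRX, rfl⟩ := hR
  have h₁ : R ≤ S := h.le
  have h₂ : S ≤ R := h.ge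
  exact ⟨X, hX, PREquivalent.trans ⟨h₂, h₁⟩ hRX, rfl⟩

theorem congr (hR : HasCount R p) (hq : IsCountFun q) (hpq : PRDominated p q)
    (hqp : PRDominated q p) : HasCount R q := by
  obtain ⟨S, hS⟩ := exists_punctualEquiv hq
  exact hS.of_deg_eq (le_antisymm ((hS.deg_le_iff hR).2 hqp) ((hR.deg_le_iff hS).2 hpq))

/-- By the normal form any competing upper bound has a count function too, so the claim reduces to
domination by a maximum of two time changes. -/
theorem isLUB (hR : HasCount R p) (hS : HasCount S q)
    (hT : HasCount T fun t => max (p t) (q t)) : IsLUB {R.deg, S.deg} T.deg := by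
  refine ⟨?_, fun d hd => ?_⟩
  · rintro d (rfl | rfl)
    · exact (hR.deg_le_iff hT).2 (.of_le fun _ => le_max_left _ _)
    · exact (hS.deg_le_iff hT).2 (.of_le fun _ => le_max_right _ _)
  · induction d using Antisymmetrization.ind with | _ U
    obtain ⟨r, hr⟩ := exists_count U
    exact (hT.deg_le_iff hr).2 (.max_le hr.isCountFun
      ((hR.deg_le_iff hr).1 (hd (.inl rfl))) ((hS.deg_le_iff hr).1 (hd (.inr rfl))))

theorem isGLB (hR : HasCount R p) (hS : HasCount S q)
    (hT : HasCount T fun t => min (p t) (q t)) : IsGLB {R.deg, S.deg} T.deg := by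
  refine ⟨?_, fun d hd => ?_⟩
  · rintro d (rfl | rfl)
    · exact (hT.deg_le_iff hR).2 (.of_le fun _ => min_le_left _ _)
    · exact (hT.deg_le_iff hS).2 (.of_le fun _ => min_le_right _ _)
  · induction d using Antisymmetrization.ind with | _ U
    obtain ⟨r, hr⟩ := exists_count U
    exact (hr.deg_le_iff hT).2 (.le_min hR.isCountFun hS.isCountFun
      ((hr.deg_le_iff hR).1 (hd (.inl rfl))) ((hr.deg_le_iff hS).1 (hd (.inr rfl))))

end HasCount

/-- The two layers of representatives collapse by transitivity of `≡_pr`. -/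
theorem diamondProperty_iff {R S : PunctualEquiv} : DiamondProperty R S ↔
    ∃ p q, HasCount R p ∧ HasCount S q ∧ ∀ s, ∃ t, s ≤ t ∧ p t = q t := by
  constructor
  · rintro ⟨X, Y, -, -, hR, hS, X', Y', hX', hY', hX, hY, h⟩
    exact ⟨_, _, ⟨X', hX', hR.trans hX.symm, rfl⟩, ⟨Y', hY', hS.trans hY.symm, rfl⟩, h⟩
  · rintro ⟨_, _, ⟨X, hX, hR, rfl⟩, ⟨Y, hY, hS, rfl⟩, h⟩
    exact ⟨X, Y, hX, hY, hR, hS, X, Y, hX, hY, .refl _, .refl _, h⟩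

-- Diamonds in the degrees and the equivalence.

theorem embedsDiamond_of_isLUB_of_isGLB {r s a b : Peq} (hrs : r < s) (hab : ¬ a ≤ b)
    (hba : ¬ b ≤ a) (hlub : IsLUB {a, b} s) (hglb : IsGLB {a, b} r) : EmbedsDiamond r s := by
  have hra : r ≤ a := hglb.1 (.inl rfl)
  have hrb : r ≤ b := hglb.1 (.inr rfl)
  have has : a ≤ s := hlub.1 (.inl rfl)
  have hbs : b ≤ s := hlub.1 (.inr rfl)
  let d : Bool × Bool → Peq := fun x => bif x.1 then bif x.2 then s else a else bif x.2 then b else r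
  have hd : ∀ x y, x ≤ y → d x ≤ d y := by
    rintro ⟨_ | _, _ | _⟩ ⟨_ | _, _ | _⟩ hxy <;>
      first
      | exact absurd hxy (by decide)
      | exact le_rfl
      | exact hrs.le
      | assumption
  have hle : ∀ x y, d x ≤ d y → x ≤ y := by
    rintro ⟨_ | _, _ | _⟩ ⟨_ | _, _ | _⟩ hxy <;>
      first
      | decide
      | exact absurd hxy hab
      | exact absurd hxy hba
      | exact absurd hxy hrs.not_ge
      | exact absurd (le_trans hxy hrb) hab
      | exact absurd (le_trans hxy hra) hba
      | exact absurd (le_trans has hxy) hab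
      | exact absurd (le_trans hbs hxy) hba
  -- Comparable pairs are settled by monotonicity, leaving only the two atoms, where `hlub` and
  -- `hglb` apply.
  have lub_le : ∀ x y, x ≤ y → IsLUB {d x, d y} (d y) := fun x y h =>
    ⟨by rintro _ (rfl | rfl); exacts [hd _ _ h, le_rfl], fun _ hu => hu (.inr rfl)⟩
  have glb_le : ∀ x y, x ≤ y → IsGLB {d x, d y} (d x) := fun x y h =>
    ⟨by rintro _ (rfl | rfl); exacts [le_rfl, hd _ _ h], fun _ hu => hu (.inl rfl)⟩
  refine ⟨fun x => ⟨d x, hd ⊥ x bot_le, hd x ⊤ le_top⟩, fun x y hxy => ?_, fun x y => ?_,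
    fun x y => ?_, rfl, rfl⟩
  · have h : d x = d y := congrArg Subtype.val hxy
    exact le_antisymm (hle _ _ h.le) (hle _ _ h.ge)
  · by_cases h : x ≤ y
    · rw [sup_eq_right.2 h]; exact lub_le _ _ h
    · by_cases h' : y ≤ x
      · rw [sup_eq_left.2 h', Set.pair_comm]; exact lub_le _ _ h'
      · rcases x with ⟨_ | _, _ | _⟩ <;> rcases y with ⟨_ | _, _ | _⟩ <;>
          first
          | exact absurd (by decide) h
          | exact absurd (by decide) h'
          | exact hlub
          | exact (Set.pair_comm a b) ▸ hlub
  · by_cases h : x ≤ y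
    · rw [inf_eq_left.2 h]; exact glb_le _ _ h
    · by_cases h' : y ≤ x
      · rw [inf_eq_right.2 h', Set.pair_comm]; exact glb_le _ _ h'
      · rcases x with ⟨_ | _, _ | _⟩ <;> rcases y with ⟨_ | _, _ | _⟩ <;>
          first
          | exact absurd (by decide) h
          | exact absurd (by decide) h'
          | exact hglb
          | exact (Set.pair_comm a b) ▸ hglb

theorem EmbedsDiamond.exists_isLUB_isGLB {r s : Peq} (h : EmbedsDiamond r s) :
    ∃ a b : Peq, ¬ a ≤ b ∧ ¬ b ≤ a ∧ IsLUB {a, b} s ∧ IsGLB {a, b} r := by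
  obtain ⟨f, hinj, hlub, hglb, hbot, htop⟩ := h
  have hl : IsLUB {(f (true, false) : Peq), (f (false, true) : Peq)} (f ⊤ : Peq) := hlub _ _
  have hg : IsGLB {(f (true, false) : Peq), (f (false, true) : Peq)} (f ⊥ : Peq) := hglb _ _
  rw [htop] at hl
  rw [hbot] at hg
  refine ⟨f (true, false), f (false, true), fun hle => ?_, fun hle => ?_, hl, hg⟩
  -- If the atoms were comparable, the larger would be their join, against injectivity.
  · have h₁ : (f ⊤ : Peq) = f (false, true) :=
      htop.trans <| le_antisymm (hl.2 (by rintro _ (rfl | rfl); exacts [hle, le_rfl])) (hl.1 (.inr rfl))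
    exact absurd (hinj (Subtype.ext h₁)) (by decide)
  · have h₁ : (f ⊤ : Peq) = f (true, false) :=
      htop.trans <| le_antisymm (hl.2 (by rintro _ (rfl | rfl); exacts [le_rfl, hle])) (hl.1 (.inl rfl))
    exact absurd (hinj (Subtype.ext h₁)) (by decide)

theorem corollary7p4 (R S : PunctualEquiv) (hRS : R < S) :
    EmbedsDiamond R.deg S.deg ↔ DiamondProperty R S := by
  rw [diamondProperty_iff]
  constructor
  · intro h
    obtain ⟨a, b, hab, hba, hlub, hglb⟩ := h.exists_isLUB_isGLB
    induction a using Antisymmetrization.ind with | _ A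
    induction b using Antisymmetrization.ind with | _ B
    obtain ⟨a, hA⟩ := HasCount.exists_count A
    obtain ⟨b, hB⟩ := HasCount.exists_count B
    obtain ⟨M, hM⟩ := HasCount.exists_punctualEquiv (hA.isCountFun.max hB.isCountFun)
    obtain ⟨m, hm⟩ := HasCount.exists_punctualEquiv (hA.isCountFun.min hB.isCountFun)
    refine ⟨_, _, hm.of_deg_eq ((hA.isGLB hB hm).unique hglb),
      hM.of_deg_eq ((hA.isLUB hB hM).unique hlub), fun s => ?_⟩
    obtain ⟨t, hst, ht⟩ := exists_eq_of_not_dominated hA.isCountFun hB.isCountFun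
      (fun hd => hab ((hA.deg_le_iff hB).2 hd)) (fun hd => hba ((hB.deg_le_iff hA).2 hd)) s
    exact ⟨t, hst, by rw [ht, min_self, max_self]⟩
  · rintro ⟨p, q, hR, hS, heq⟩
    have hpq := (hR.le_iff hS).1 hRS.le
    have hp := hR.isCountFun
    have hq := hS.isCountFun
    -- As `p` is dominated by `q`, the minimum still represents `R` and the maximum `S`; this
    -- arranges a pointwise inequality and keeps the agreements.
    have hmin := hR.congr (hp.min hq) (.le_min hp hq (.refl p) hpq) (.of_le fun _ => min_le_left _ _)
    have hmax := hS.congr (hp.max hq) (.of_le fun _ => le_max_right _ _) (.max_le hq hpq (.refl q))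
    obtain ⟨a, b, ha, hb, hmin', hmax', hab, hba⟩ := exists_incomparable_of_coincidences
      (hp.min hq) (hp.max hq) (fun t => (min_le_left _ _).trans (le_max_left _ _))
      (fun hd => hRS.not_ge ((hmax.le_iff hmin).2 hd))
      (fun s => by
        obtain ⟨t, hst, ht⟩ := heq s
        exact ⟨t, hst, by rw [ht, min_self, max_self]⟩)
    obtain ⟨A, hA⟩ := HasCount.exists_punctualEquiv ha
    obtain ⟨B, hB⟩ := HasCount.exists_punctualEquiv hb
    exact embedsDiamond_of_isLUB_of_isGLB (r := R.deg) (s := S.deg) (a := A.deg) (b := B.deg)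
      (toAntisymmetrization_lt_toAntisymmetrization_iff.2 hRS)
      (fun h => hab ((hA.deg_le_iff hB).1 h)) (fun h => hba ((hB.deg_le_iff hA).1 h))
      (hA.isLUB hB (by simpa only [hmax'] using hmax)) (hA.isGLB hB (by simpa only [hmin'] using hmin))
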